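/- Let $\mathcal S$ and $\mathcal Y$ be finite sets and let $\mathcal X$ be a set of inputs. Consider a discrete channel with i.i.d. states: the states $S_1,S_2,\dots$ are i.i.d. on $\mathcal S$ with law $P_S$, and, given the states and the inputs, the outputs are independent with $Y_i\sim P_{Y|XS}(\cdot\mid x_i,s_i)$ on $\mathcal Y$. Each input $x$ has a cost $b(x)\in[0,\infty)$, and there is an input $0\in\mathcal X$ with $b(0)=0$. The transmitter has causal state information, so that the input at time $i$ is a function of the message and of $S_1,\dots,S_i$; the receiver has no state information. An $(l,M,\nu,\epsilon)$ code has block length $l$ and $M\ge1$ messages, its error probability averaged over the messages is at most $\epsilon$, and for every message the transmitted inputs satisfy $\sum_{i=1}^l b(x_i)\le\nu$ for every state sequence of positive probability. A rate $R\ge 0$ is achievable per unit cost if for every $\epsilon\in(0,1)$ and every $\gamma>0$ there is a $\nu_0$ such that for every $\nu\ge\nu_0$ there is an $(l,M,\nu,\epsilon)$ code with $\ln M\ge\nu(R-\gamma)$. The capacity per unit cost is the largest achievable rate ($\infty$ if the achievable rates are unbounded). Then the capacity per unit cost equals $$\sup_{u:\mathcal S\to\mathcal X}\frac{D(P_{Y|U=u}\,\|\,P_{Y|U=0})}{\mathbb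 E[b(X)\mid U=u]}\in[0,\infty],$$ where $P_{Y|U=u}(y)=\sum_{s}P_S(s)P_{Y|XS}(y\mid u(s),s)$, $U=0$ is the map that is identically $0$, $\mathbb E[b(X)\mid U=u]=\sum_s P_S(s)\,b(u(s))$, $D$ is relative entropy in nats (possibly $\infty$), and a quotient with denominator $0$ is read as $0$ if its numerator is $0$ and as $\infty$ otherwise. If this value is finite, it is itself an achievable rate. -/

import Mathlib

open scoped NNReal ENNReal

/-- A discrete channel with input alphabet `X`, state alphabet `S` and output alphabet `Y`:
the law of one state (the states are i.i.d. over time), the transition law of the output given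
input and state, a finite nonnegative cost for each input, and a zero-cost input. -/
structure StateChannel (X S Y : Type*) where
  /-- the law `P_S` of one state -/
  stateDist : PMF S
  /-- `trans x s` is the law `P_{Y|XS}(· | x, s)` -/
  trans : X → S → PMF Y
  /-- the cost `b(x)` -/
  cost : X → ℝ≥0
  /-- the distinguished input "0" -/
  zeroInput : X
  cost_zeroInput : cost zeroInput = 0

/-- A block code of length `l` with `M` messages, causal state information at the transmitter and
none at the receiver: `enc m s i` is the input sent at time `i` for message `m` when the state
sequence is `s`, and the decoder sees only the outputs. -/
structure CausalCode (X S Y : Type*) (l M : ℕ) where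
  enc : Fin M → (Fin l → S) → Fin l → X
  /-- the input at time `i` depends only on the message and the states up to time `i` -/
  causal : ∀ (m : Fin M) (i : Fin l) (s s' : Fin l → S),
    (∀ k, k ≤ i → s k = s' k) → enc m s i = enc m s' i
  dec : (Fin l → Y) → Fin M

namespace StateChannel

variable {X S Y : Type*} [Fintype S] [Fintype Y]

/-- The probability of a state sequence, for i.i.d. states. -/
noncomputable def stateSeqProb (W : StateChannel X S Y) {l : ℕ} (s : Fin l → S) : ℝ≥0∞ :=
  ∏ i, W.stateDist (s i)

/-- The probability of an output sequence given the input and state sequences, for a channel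
that is memoryless given the states. -/
noncomputable def outputSeqProb (W : StateChannel X S Y) {l : ℕ}
    (x : Fin l → X) (s : Fin l → S) (y : Fin l → Y) : ℝ≥0∞ :=
  ∏ i, W.trans (x i) (s i) (y i)

/-- The probability that the decoder is wrong when message `m` is sent. -/
noncomputable def errorProb (W : StateChannel X S Y) {l M : ℕ} (c : CausalCode X S Y l M)
    (m : Fin M) : ℝ≥0∞ :=
  ∑ s : Fin l → S, W.stateSeqProb s *
    ∑ y : Fin l → Y with c.dec y ≠ m, W.outputSeqProb (c.enc m s) s y

/-- The error probability averaged over the `M` messages. -/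
noncomputable def avgErrorProb (W : StateChannel X S Y) {l M : ℕ}
    (c : CausalCode X S Y l M) : ℝ≥0∞ :=
  (∑ m : Fin M, W.errorProb c m) / M

/-- `c` is an `(l, M, ν, ε)` code: there is at least one message, the average error probability is
at most `ε`, and for each message the total cost of the transmitted codeword is at most `ν`,
whichever state sequence (of positive probability) occurs. -/
def IsCode (W : StateChannel X S Y) {l M : ℕ} (c : CausalCode X S Y l M) (ν ε : ℝ) : Prop :=
  1 ≤ M ∧ W.avgErrorProb c ≤ ENNReal.ofReal ε ∧
    ∀ (m : Fin M) (s : Fin l → S), W.stateSeqProb s ≠ 0 →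
      ∑ i, (W.cost (c.enc m s i) : ℝ) ≤ ν

/-- `R` (in nats per unit cost) is an `ε`-achievable rate per unit cost. -/
def EpsAchievable (W : StateChannel X S Y) (ε R : ℝ) : Prop :=
  ∀ γ : ℝ, 0 < γ → ∃ ν₀ : ℝ, ∀ ν : ℝ, ν₀ ≤ ν →
    ∃ (l M : ℕ) (c : CausalCode X S Y l M), W.IsCode c ν ε ∧ ν * (R - γ) ≤ Real.log M

/-- `R` is an achievable rate per unit cost. -/
def Achievable (W : StateChannel X S Y) (R : ℝ) : Prop :=
  ∀ ε : ℝ, 0 < ε → ε < 1 → W.EpsAchievable ε R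

/-- The capacity per unit cost: the supremum, possibly `∞`, of the achievable rates. -/
noncomputable def capacityPerUnitCost (W : StateChannel X S Y) : ℝ≥0∞ :=
  ⨆ (R : ℝ≥0) (_ : W.Achievable R), (R : ℝ≥0∞)

/-- The law `P_{Y|U=u}` of the output when the input is `u s` in state `s`, that is,
`y ↦ ∑ s, P_S(s) P_{Y|XS}(y | u(s), s)`. -/
noncomputable def outputDist (W : StateChannel X S Y) (u : S → X) : PMF Y :=
  W.stateDist.bind fun s => W.trans (u s) s

/-- The average cost `E[b(X) | U = u]`. -/
noncomputable def expectedCost (W : StateChannel X S Y) (u : S → X) : ℝ≥0∞ :=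
  ∑ s, W.stateDist s * (W.cost (u s) : ℝ≥0∞)

/-- The divergence `D(P_{Y|U=u} ‖ P_{Y|U=0})` in nats, where `U = 0` sends the zero input in every
state. -/
noncomputable def divergenceFromZero (W : StateChannel X S Y) [MeasurableSpace Y] (u : S → X) :
    ℝ≥0∞ :=
  InformationTheory.klDiv (W.outputDist u).toMeasure
    (W.outputDist fun _ => W.zeroInput).toMeasure

end StateChannel

/-! Write `q` for the output law of the zero input. Converse: if `C` is finite and bounds every
quotient, the Gibbs inequality gives `E f ≤ log E_q exp f + C * E cost` for one channel use and any
`f`. This form tensorizes: `causal_sum_le_log_sum_exp_add` peels off the first use and takes the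
log-moment of the remaining block as the new `f`, so no mutual information is needed. With `f = log
M` on the decoding region of message `m` and `0` elsewhere, averaging over `m` yields `(1 - ε) log M
≤ C ν + log 2`. Direct part: block length is free and the zero input costs nothing, so pulse
position modulation works: message `m` uses `u` in the `m`-th of `M` slots of length `n`. A test
function `L` with `E_q exp L ≤ 1` and mean above `r` under `u` makes each false alarm at most `exp
(-r n)`, so about `exp (r' n)` messages with `r' < r` are separated. Cost overshoot has
exponentially small probability, and truncation, which is causal, turns the average cost bound into
a sure one. -/

/-! ### Exponential moments. -/

/-- Chernoff bound for the total mass that a product of weights puts on `{a | 0 ≤ ∑ i, g i (a i)}`. -/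
theorem sum_prod_filter_le_prod_sum_exp {ι α : Type*} [Fintype ι] [DecidableEq ι] [Fintype α]
    (p g : ι → α → ℝ) (hp : ∀ i x, 0 ≤ p i x) :
    ∑ a : ι → α with 0 ≤ ∑ i, g i (a i), ∏ i, p i (a i) ≤
      ∏ i, ∑ x, p i x * Real.exp (g i x) := by
  rw [Finset.prod_univ_sum, Fintype.piFinset_univ]
  calc _ ≤ ∑ a : ι → α with 0 ≤ ∑ i, g i (a i), ∏ i, p i (a i) * Real.exp (g i (a i)) := by
        refine Finset.sum_le_sum fun a ha => ?_
        rw [Finset.prod_mul_distrib, ← Real.exp_sum]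
        exact le_mul_of_one_le_right (Finset.prod_nonneg fun i _ => hp _ _)
          (Real.one_le_exp (Finset.mem_filter.1 ha).2)
    _ ≤ _ := Finset.sum_le_sum_of_subset_of_nonneg (Finset.filter_subset _ _) fun a _ _ =>
        Finset.prod_nonneg fun i _ => mul_nonneg (hp _ _) (Real.exp_nonneg _)

/-- Small exponential moments of a function with negative mean are less than one. -/
theorem eventually_sum_mul_exp_lt_one {α : Type*} [Fintype α] (p g : α → ℝ)
    (hp : ∑ x, p x = 1) (hg : ∑ x, p x * g x < 0) :
    ∀ᶠ t : ℝ in nhdsWithin 0 (Set.Ioi 0), ∑ x, p x * Real.exp (t * g x) < 1 := by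
  -- At `t = 0` the moment is 1 and its derivative is the mean, so slopes to the right are
  -- eventually negative.
  have hd : HasDerivAt (fun t : ℝ => ∑ x, p x * Real.exp (t * g x)) (∑ x, p x * g x) 0 := by
    refine HasDerivAt.fun_sum fun x _ => ?_
    have := (((hasDerivAt_id (0 : ℝ)).mul_const (g x)).exp).const_mul (p x)
    simpa using this
  have hs := (hasDerivAt_iff_tendsto_slope.1 hd).mono_left
    (nhdsWithin_mono 0 (fun t (ht : t ∈ Set.Ioi (0 : ℝ)) => ne_of_gt ht))
  filter_upwards [hs.eventually_lt_const hg, self_mem_nhdsWithin] with t ht ht0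
  rw [slope_def_field] at ht
  have ht0' : (0 : ℝ) < t := ht0
  rw [div_lt_iff₀ (by simpa using ht0')] at ht
  simp [hp] at ht
  linarith

/-- The Gibbs variational inequality. -/
theorem sum_mul_le_log_sum_exp_add {α : Type*} [Fintype α] (p q f : α → ℝ)
    (hp : ∀ x, 0 ≤ p x) (hq : ∀ x, 0 ≤ q x) (hp1 : ∑ x, p x = 1)
    (hpq : ∀ x, q x = 0 → p x = 0) :
    ∑ x, p x * f x ≤
      Real.log (∑ x, q x * Real.exp (f x)) + ∑ x, p x * Real.log (p x / q x) := by
  set Z := ∑ x, q x * Real.exp (f x) with hZ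
  have hex : ∃ x, 0 < p x := by
    by_contra! h
    have : ∑ x, p x = 0 := Finset.sum_eq_zero fun x _ => le_antisymm (h x) (hp x)
    linarith
  obtain ⟨x₀, hx₀⟩ := hex
  have hqpos : ∀ x, 0 < p x → 0 < q x := fun x hx =>
    lt_of_le_of_ne (hq x) fun h => hx.ne' (hpq x h.symm)
  have hZpos : 0 < Z := Finset.sum_pos' (fun x _ => mul_nonneg (hq x) (Real.exp_nonneg _))
    ⟨x₀, Finset.mem_univ _, mul_pos (hqpos x₀ hx₀) (Real.exp_pos _)⟩
  -- This is `log z ≤ z - 1` at `z = q exp f / (Z p)`, multiplied by `p`; the right-hand sides sum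
  -- to 0.
  have key : ∀ x, p x * f x - p x * Real.log (p x / q x) - p x * Real.log Z ≤
      q x * Real.exp (f x) / Z - p x := by
    intro x
    rcases (hp x).eq_or_lt with h | h
    · rw [← h]
      simpa using div_nonneg (mul_nonneg (hq x) (Real.exp_nonneg _)) hZpos.le
    · have hqx := hqpos x h
      have hl := Real.log_le_sub_one_of_pos
        (show 0 < q x * Real.exp (f x) / Z / p x by positivity)
      rw [Real.log_div (by positivity) h.ne', Real.log_div (by positivity) hZpos.ne',
        Real.log_mul hqx.ne' (Real.exp_ne_zero _), Real.log_exp] at hl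
      rw [Real.log_div h.ne' hqx.ne']
      have hm := mul_le_mul_of_nonneg_left hl h.le
      have : p x * (q x * Real.exp (f x) / Z / p x - 1) = q x * Real.exp (f x) / Z - p x := by
        field_simp
      rw [this] at hm
      linarith
  have := Finset.sum_le_sum fun x (_ : x ∈ Finset.univ) => key x
  simp only [Finset.sum_sub_distrib, ← Finset.sum_mul, ← Finset.sum_div, hp1, ← hZ,
    div_self hZpos.ne'] at this
  linarith

/-! ### Relative entropy on a finite alphabet. -/

namespace PMF

variable {α : Type*}

theorem toReal_nonneg (p : PMF α) (x : α) : 0 ≤ (p x).toReal := ENNReal.toReal_nonneg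

theorem sum_toReal [Fintype α] (p : PMF α) : ∑ x, (p x).toReal = 1 := by
  rw [← ENNReal.toReal_sum fun x _ => p.apply_ne_top x, ← tsum_fintype (L := .unconditional α),
    p.tsum_coe, ENNReal.toReal_one]

theorem toReal_eq_zero_iff (p : PMF α) (x : α) : (p x).toReal = 0 ↔ p x = 0 := by
  simp [ENNReal.toReal_eq_zero_iff, p.apply_ne_top x]

variable [Fintype α] [MeasurableSpace α] [MeasurableSingletonClass α]

theorem absolutelyContinuous_toMeasure_iff (p q : PMF α) :
    p.toMeasure.AbsolutelyContinuous q.toMeasure ↔ ∀ x, q x = 0 → p x = 0 := by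
  refine ⟨fun h x hx => ?_, fun h s hs => ?_⟩
  · have := h (s := {x}) (by rwa [q.toMeasure_apply_singleton x (measurableSet_singleton x)])
    rwa [p.toMeasure_apply_singleton x (measurableSet_singleton x)] at this
  · have hm : MeasurableSet s := s.toFinite.measurableSet
    rw [toMeasure_apply_eq_zero_iff _ hm] at hs ⊢
    exact hs.mono_left fun x hx hq => hx (h x hq)

/-- Relative entropy on a finite alphabet. -/
theorem klDiv_toMeasure (p q : PMF α) (h : ∀ x, q x = 0 → p x = 0) :
    InformationTheory.klDiv p.toMeasure q.toMeasure ≠ ∞ ∧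
      (InformationTheory.klDiv p.toMeasure q.toMeasure).toReal =
        ∑ x, (p x).toReal * Real.log ((p x).toReal / (q x).toReal) := by
  have hac := (absolutelyContinuous_toMeasure_iff p q).2 h
  refine ⟨InformationTheory.klDiv_ne_top hac .of_finite, ?_⟩
  rw [InformationTheory.toReal_klDiv_of_measure_eq hac (by simp), PMF.integral_eq_sum]
  refine Finset.sum_congr rfl fun x _ => ?_
  by_cases hp : p x = 0
  · simp [hp]
  have hq : q x ≠ 0 := fun hq => hp (h x hq)
  -- Evaluating `withDensity` on a singleton identifies the density at `x` with the ratio of the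
  -- point masses.
  have hd := congrArg (fun μ : MeasureTheory.Measure α => μ {x})
    (MeasureTheory.Measure.withDensity_rnDeriv_eq _ _ hac)
  simp only [MeasureTheory.withDensity_apply _ (measurableSet_singleton x),
    MeasureTheory.lintegral_singleton,
    toMeasure_apply_singleton _ x (measurableSet_singleton x)] at hd
  rw [MeasureTheory.llr, ← hd, ENNReal.toReal_mul, smul_eq_mul,
    mul_div_cancel_right₀ _ (by simpa [toReal_eq_zero_iff] using hq)]

theorem klDiv_toMeasure_eq_top (p q : PMF α) {x : α} (hq : q x = 0) (hp : p x ≠ 0) :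
    InformationTheory.klDiv p.toMeasure q.toMeasure = ∞ :=
  InformationTheory.klDiv_of_not_ac fun h =>
    hp ((absolutelyContinuous_toMeasure_iff p q).1 h x hq)

theorem sum_mul_le_log_sum_exp_add_klDiv (p q : PMF α)
    (h : InformationTheory.klDiv p.toMeasure q.toMeasure ≠ ∞) (f : α → ℝ) :
    ∑ x, (p x).toReal * f x ≤ Real.log (∑ x, (q x).toReal * Real.exp (f x)) +
      (InformationTheory.klDiv p.toMeasure q.toMeasure).toReal := by
  have hpq : ∀ x, q x = 0 → p x = 0 := fun x hq => by
    by_contra hp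
    exact h (klDiv_toMeasure_eq_top p q hq hp)
  rw [(klDiv_toMeasure p q hpq).2]
  refine sum_mul_le_log_sum_exp_add _ _ f p.toReal_nonneg q.toReal_nonneg p.sum_toReal ?_
  simpa [toReal_eq_zero_iff] using hpq

/-- Numbers below the relative entropy are exceeded by its variational formula. -/
theorem exists_sum_mul_exp_le_one (p q : PMF α) {r : ℝ}
    (h : ENNReal.ofReal r < InformationTheory.klDiv p.toMeasure q.toMeasure) :
    ∃ L : α → ℝ, ∑ x, (q x).toReal * Real.exp (L x) ≤ 1 ∧ r < ∑ x, (p x).toReal * L x := by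
  classical
  by_cases hpq : ∀ x, q x = 0 → p x = 0
  · obtain ⟨hfin, hD⟩ := klDiv_toMeasure p q hpq
    set D := (InformationTheory.klDiv p.toMeasure q.toMeasure).toReal
    have hr : r < D := by
      rw [← ENNReal.ofReal_toReal hfin] at h
      exact ENNReal.ofReal_lt_ofReal_iff'.1 h |>.1
    obtain ⟨δ, hδ, hrδ⟩ : ∃ δ : ℝ, 0 < δ ∧ r + δ < D := ⟨(D - r) / 2, by linarith, by linarith⟩
    -- Where `p` vanishes the log-likelihood ratio would be `-∞`. Lowering it by `δ` elsewhere frees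
    -- mass `1 - exp (-δ)`, which pays for a finite value there.
    refine ⟨fun x => if p x = 0 then Real.log (1 - Real.exp (-δ)) else
      Real.log ((p x).toReal / (q x).toReal) - δ, ?_, ?_⟩
    · have hδ1 : Real.exp (-δ) < 1 := by simpa using hδ
      calc _ ≤ ∑ x, ((q x).toReal * (1 - Real.exp (-δ)) + (p x).toReal * Real.exp (-δ)) := by
            refine Finset.sum_le_sum fun x _ => ?_
            by_cases hp : p x = 0
            · simp [hp, Real.exp_log (sub_pos.2 hδ1)]
            · beta_reduce
              have hq : q x ≠ 0 := fun hq => hp (hpq x hq)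
              have hp' : 0 < (p x).toReal := ENNReal.toReal_pos hp (p.apply_ne_top x)
              have hq' : 0 < (q x).toReal := ENNReal.toReal_pos hq (q.apply_ne_top x)
              rw [if_neg hp, sub_eq_add_neg, Real.exp_add, Real.exp_log (by positivity)]
              have : (q x).toReal * ((p x).toReal / (q x).toReal * Real.exp (-δ)) =
                (p x).toReal * Real.exp (-δ) := by field_simp
              rw [this]
              exact le_add_of_nonneg_left (mul_nonneg hq'.le (sub_pos.2 hδ1).le)
        _ ≤ 1 := by
            rw [Finset.sum_add_distrib, ← Finset.sum_mul, ← Finset.sum_mul, p.sum_toReal,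
              q.sum_toReal]
            linarith
    · have : ∑ x, (p x).toReal * (if p x = 0 then Real.log (1 - Real.exp (-δ)) else
          Real.log ((p x).toReal / (q x).toReal) - δ) =
          ∑ x, ((p x).toReal * Real.log ((p x).toReal / (q x).toReal) - (p x).toReal * δ) := by
        refine Finset.sum_congr rfl fun x _ => ?_
        by_cases hp : p x = 0
        · simp [hp]
        · rw [if_neg hp, mul_sub]
      rw [this, Finset.sum_sub_distrib, ← Finset.sum_mul, p.sum_toReal, ← hD]
      linarith
  · push Not at hpq
    obtain ⟨x₀, hq, hp⟩ := hpq
    have hp' : 0 < (p x₀).toReal := ENNReal.toReal_pos hp (p.apply_ne_top x₀)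
    -- A value at a `q`-null atom is free under `q`, so it can be as large as the mean under `p`
    -- requires.
    refine ⟨fun x => if x = x₀ then (|r| + 1) / (p x₀).toReal else 0, ?_, ?_⟩
    · refine (Finset.sum_le_sum fun x _ => ?_).trans q.sum_toReal.le
      by_cases hx : x = x₀
      · simp [hx, hq]
      · simp [hx]
    · simp only [mul_ite, mul_zero, Finset.sum_ite_eq', Finset.mem_univ, if_true]
      rw [mul_div_cancel₀ _ hp'.ne']
      linarith [le_abs_self r]

end PMF

/-! ### Tensorization over a block with causal inputs. -/

theorem Fintype.sum_fin_succ_pi {α M : Type*} [Fintype α] [AddCommMonoid M] {l : ℕ}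
    (F : (Fin (l + 1) → α) → M) :
    ∑ a, F a = ∑ x : α, ∑ a : Fin l → α, F (Fin.cons x a) := by
  rw [← Fintype.sum_prod_type', ← (Fin.consEquiv fun _ : Fin (l + 1) => α).sum_comp]
  rfl

theorem Fintype.sum_prod_apply_eq_one {ι α : Type*} [Fintype ι] [DecidableEq ι] [Fintype α]
    (p : ι → α → ℝ) (hp : ∀ i, ∑ x, p i x = 1) : ∑ a : ι → α, ∏ i, p i (a i) = 1 := by
  have := Finset.prod_univ_sum (fun _ : ι => (Finset.univ : Finset α)) p
  rw [Fintype.piFinset_univ] at this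
  rw [← this, Finset.prod_congr rfl fun i _ => hp i, Finset.prod_const_one]

/-- If one use of a channel with states moves the mean of any function by at most its log-moment
under `q` plus `C` times the cost, then so does a block of uses with causal inputs. -/
theorem causal_sum_le_log_sum_exp_add {X S Y : Type*} [Fintype S] [Fintype Y] [Nonempty S]
    (p : S → ℝ) (w : X → S → Y → ℝ) (q : Y → ℝ) (b : X → ℝ) (C : ℝ)
    (hp : ∀ s, 0 ≤ p s) (hp1 : ∑ s, p s = 1) (hw : ∀ x s y, 0 ≤ w x s y)
    (hw1 : ∀ x s, ∑ y, w x s y = 1) (hq : ∀ y, 0 ≤ q y) (hq1 : ∑ y, q y = 1)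
    (h : ∀ (u : S → X) (f : Y → ℝ), ∑ s, p s * ∑ y, w (u s) s y * f y ≤
      Real.log (∑ y, q y * Real.exp (f y)) + C * ∑ s, p s * b (u s))
    (l : ℕ) (x : (Fin l → S) → Fin l → X)
    (hx : ∀ (i : Fin l) (s s' : Fin l → S), (∀ k, k ≤ i → s k = s' k) → x s i = x s' i)
    (f : (Fin l → Y) → ℝ) :
    ∑ s : Fin l → S, (∏ i, p (s i)) * ∑ y : Fin l → Y, (∏ i, w (x s i) (s i) (y i)) * f y ≤
      Real.log (∑ y : Fin l → Y, (∏ i, q (y i)) * Real.exp (f y)) +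
        C * ∑ s : Fin l → S, (∏ i, p (s i)) * ∑ i, b (x s i) := by
  induction l with
  | zero => simp
  | succ l ih =>
    let u : S → X := fun s₀ => x (fun _ => s₀) 0
    let x' : S → (Fin l → S) → Fin l → X := fun s₀ s i => x (Fin.cons s₀ s) i.succ
    have hu : ∀ s₀ (s : Fin l → S), x (Fin.cons s₀ s) 0 = u s₀ := fun s₀ s =>
      hx 0 _ _ fun k hk => by
        obtain rfl : k = 0 := by simpa using hk
        simp
    have hx' : ∀ s₀ (i : Fin l) (s s' : Fin l → S), (∀ k, k ≤ i → s k = s' k) →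
        x' s₀ s i = x' s₀ s' i := fun s₀ i s s' hs => hx _ _ _ fun k hk => by
      cases k using Fin.cases with
      | zero => simp
      | succ k => simpa using hs k (by simpa using hk)
    -- The log-moment of the remaining block given the first output, so that `E_q exp g` is the
    -- moment of the whole block.
    let g : Y → ℝ := fun y₀ =>
      Real.log (∑ y : Fin l → Y, (∏ i, q (y i)) * Real.exp (f (Fin.cons y₀ y)))
    -- The remaining expected cost depends on `s₀` but not on the first output, as there is no
    -- feedback.
    let c : S → ℝ := fun s₀ => ∑ s : Fin l → S, (∏ i, p (s i)) * ∑ i, b (x' s₀ s i)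
    have hpl : ∑ s : Fin l → S, ∏ i, p (s i) = 1 :=
      Fintype.sum_prod_apply_eq_one (fun _ => p) fun _ => hp1
    have hql : ∑ y : Fin l → Y, ∏ i, q (y i) = 1 :=
      Fintype.sum_prod_apply_eq_one (fun _ => q) fun _ => hq1
    have hcost : ∑ s : Fin (l + 1) → S, (∏ i, p (s i)) * ∑ i, b (x s i) =
        ∑ s₀, p s₀ * b (u s₀) + ∑ s₀, p s₀ * c s₀ := by
      rw [Fintype.sum_fin_succ_pi, ← Finset.sum_add_distrib]
      refine Finset.sum_congr rfl fun s₀ _ => ?_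
      simp only [Fin.prod_univ_succ, Fin.sum_univ_succ, Fin.cons_zero, Fin.cons_succ, hu, mul_add,
        Finset.sum_add_distrib]
      congr 1
      · rw [← Finset.sum_mul, ← Finset.mul_sum, hpl, mul_one]
      · simp only [c, x', Finset.mul_sum, mul_assoc]
    have hexp : ∑ y : Fin (l + 1) → Y, (∏ i, q (y i)) * Real.exp (f y) =
        ∑ y₀, q y₀ * Real.exp (g y₀) := by
      rw [Fintype.sum_fin_succ_pi]
      refine Finset.sum_congr rfl fun y₀ _ => ?_
      have hpos : 0 < ∑ y : Fin l → Y, (∏ i, q (y i)) * Real.exp (f (Fin.cons y₀ y)) := by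
        obtain ⟨y, hy⟩ : ∃ y : Fin l → Y, 0 < ∏ i, q (y i) := by
          by_contra! hneg
          have := Finset.sum_nonpos fun (y : Fin l → Y) (_ : y ∈ Finset.univ) => hneg y
          linarith
        exact Finset.sum_pos' (fun y _ => mul_nonneg (Finset.prod_nonneg fun i _ => hq _)
          (Real.exp_nonneg _)) ⟨y, Finset.mem_univ _, mul_pos hy (Real.exp_pos _)⟩
      simp only [g, Real.exp_log hpos, Fin.prod_univ_succ, Fin.cons_zero, Fin.cons_succ,
        Finset.mul_sum, mul_assoc]
    have hmean : ∑ s : Fin (l + 1) → S, (∏ i, p (s i)) *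
        ∑ y : Fin (l + 1) → Y, (∏ i, w (x s i) (s i) (y i)) * f y =
        ∑ s₀, p s₀ * ∑ y₀, w (u s₀) s₀ y₀ * ∑ s : Fin l → S, (∏ i, p (s i)) *
          ∑ y : Fin l → Y, (∏ i, w (x' s₀ s i) (s i) (y i)) * f (Fin.cons y₀ y) := by
      rw [Fintype.sum_fin_succ_pi]
      refine Finset.sum_congr rfl fun s₀ _ => ?_
      simp only [Finset.mul_sum]
      rw [Finset.sum_comm, Fintype.sum_fin_succ_pi]
      refine Finset.sum_congr rfl fun y₀ _ => ?_
      rw [Finset.sum_comm]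
      refine Finset.sum_congr rfl fun s _ => Finset.sum_congr rfl fun y _ => ?_
      simp only [Fin.prod_univ_succ, Fin.cons_zero, Fin.cons_succ, hu, x']
      ring
    rw [hmean, hcost, hexp]
    calc _ ≤ ∑ s₀, p s₀ * ∑ y₀, w (u s₀) s₀ y₀ * (g y₀ + C * c s₀) := by
          gcongr with s₀ _ y₀ _
          · exact hp s₀
          · exact hw _ _ _
          · exact ih (x' s₀) (hx' s₀) fun y => f (Fin.cons y₀ y)
      _ = ∑ s₀, p s₀ * ∑ y₀, w (u s₀) s₀ y₀ * g y₀ + C * ∑ s₀, p s₀ * c s₀ := by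
          rw [Finset.mul_sum, ← Finset.sum_add_distrib]
          refine Finset.sum_congr rfl fun s₀ _ => ?_
          simp only [mul_add, Finset.sum_add_distrib, ← Finset.sum_mul, hw1]
          ring
      _ ≤ _ := by linarith [h u g]

/-! ### Real-valued probabilities and the converse. -/

namespace StateChannel

variable {X S Y : Type*} (W : StateChannel X S Y)

theorem toReal_outputDist [Fintype S] (u : S → X) (y : Y) : (W.outputDist u y).toReal =
    ∑ s, (W.stateDist s).toReal * (W.trans (u s) s y).toReal := by
  rw [outputDist, PMF.bind_apply, tsum_fintype, ENNReal.toReal_sum fun s _ =>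
    ENNReal.mul_ne_top (PMF.apply_ne_top _ _) (PMF.apply_ne_top _ _)]
  simp only [ENNReal.toReal_mul]

theorem toReal_expectedCost [Fintype S] (u : S → X) : (W.expectedCost u).toReal =
    ∑ s, (W.stateDist s).toReal * (W.cost (u s) : ℝ) := by
  rw [expectedCost, ENNReal.toReal_sum fun s _ =>
    ENNReal.mul_ne_top (PMF.apply_ne_top _ _) ENNReal.coe_ne_top]
  simp only [ENNReal.toReal_mul, ENNReal.coe_toReal]

theorem expectedCost_ne_top [Fintype S] (u : S → X) : W.expectedCost u ≠ ∞ :=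
  ENNReal.sum_ne_top.2 fun _ _ => ENNReal.mul_ne_top (PMF.apply_ne_top _ _) ENNReal.coe_ne_top

variable {l M : ℕ}

theorem outputSeqProb_ne_top (x : Fin l → X) (s : Fin l → S) (y : Fin l → Y) :
    W.outputSeqProb x s y ≠ ∞ :=
  ENNReal.prod_ne_top fun _ _ => PMF.apply_ne_top _ _

theorem stateSeqProb_ne_top (s : Fin l → S) : W.stateSeqProb s ≠ ∞ :=
  ENNReal.prod_ne_top fun _ _ => PMF.apply_ne_top _ _

theorem errorProb_ne_top [Fintype S] [Fintype Y] (c : CausalCode X S Y l M) (m : Fin M) : W.errorProb c m ≠ ∞ :=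
  ENNReal.sum_ne_top.2 fun s _ => ENNReal.mul_ne_top (W.stateSeqProb_ne_top s) <|
    ENNReal.sum_ne_top.2 fun y _ => W.outputSeqProb_ne_top _ s y

theorem toReal_errorProb [Fintype S] [Fintype Y] (c : CausalCode X S Y l M) (m : Fin M) : (W.errorProb c m).toReal =
    ∑ s : Fin l → S, (∏ i, (W.stateDist (s i)).toReal) *
      ∑ y : Fin l → Y with c.dec y ≠ m, ∏ i, (W.trans (c.enc m s i) (s i) (y i)).toReal := by
  rw [errorProb, ENNReal.toReal_sum fun s _ => ENNReal.mul_ne_top (W.stateSeqProb_ne_top s) <|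
    ENNReal.sum_ne_top.2 fun y _ => W.outputSeqProb_ne_top _ s y]
  refine Finset.sum_congr rfl fun s _ => ?_
  rw [ENNReal.toReal_mul, ENNReal.toReal_sum fun y _ => W.outputSeqProb_ne_top _ s y]
  simp only [stateSeqProb, outputSeqProb, ENNReal.toReal_prod]

theorem sum_stateSeq_toReal [Fintype S] : ∑ s : Fin l → S, ∏ i, (W.stateDist (s i)).toReal = 1 :=
  Fintype.sum_prod_apply_eq_one (fun _ s => (W.stateDist s).toReal) fun _ => W.stateDist.sum_toReal

theorem sum_outputSeq_toReal [Fintype Y] (x : Fin l → X) (s : Fin l → S) :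
    ∑ y : Fin l → Y, ∏ i, (W.trans (x i) (s i) (y i)).toReal = 1 :=
  Fintype.sum_prod_apply_eq_one (fun i y => (W.trans (x i) (s i) y).toReal)
    fun i => (W.trans (x i) (s i)).sum_toReal

theorem toReal_avgErrorProb [Fintype S] [Fintype Y] (c : CausalCode X S Y l M) :
    (W.avgErrorProb c).toReal = (∑ m, (W.errorProb c m).toReal) / M := by
  rw [avgErrorProb, ENNReal.toReal_div, ENNReal.toReal_sum fun m _ => W.errorProb_ne_top c m,
    ENNReal.toReal_natCast]

variable [Fintype S] [Fintype Y] [MeasurableSpace Y] [MeasurableSingletonClass Y]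

/-- A Fano-type bound on the size of a code. -/
theorem log_card_le_of_isCode {C : ℝ} (hC : 0 ≤ C)
    (hD : ∀ u, W.divergenceFromZero u ≤ ENNReal.ofReal C * W.expectedCost u)
    (c : CausalCode X S Y l M) {ν ε : ℝ} (hε : 0 < ε) (hc : W.IsCode c ν ε) :
    (1 - ε) * Real.log M ≤ C * ν + Real.log 2 := by
  classical
  obtain ⟨hM, herr, hcost⟩ := hc
  have hM0 : (0 : ℝ) < M := by exact_mod_cast hM
  have : Nonempty S := ⟨W.stateDist.support_nonempty.some⟩
  set p : S → ℝ := fun s => (W.stateDist s).toReal with hpdef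
  set w : X → S → Y → ℝ := fun x s y => (W.trans x s y).toReal with hwdef
  set q : Y → ℝ := fun y => (W.outputDist (fun _ => W.zeroInput) y).toReal with hqdef
  have hp : ∀ s, 0 ≤ p s := fun s => ENNReal.toReal_nonneg
  have hq : ∀ y, 0 ≤ q y := fun s => ENNReal.toReal_nonneg
  have hq1 : ∑ y, q y = 1 := PMF.sum_toReal _
  have hstep : ∀ (u : S → X) (f : Y → ℝ), ∑ s, p s * ∑ y, w (u s) s y * f y ≤
      Real.log (∑ y, q y * Real.exp (f y)) + C * ∑ s, p s * (W.cost (u s) : ℝ) := by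
    intro u f
    have htop : ENNReal.ofReal C * W.expectedCost u ≠ ∞ :=
      ENNReal.mul_ne_top ENNReal.ofReal_ne_top (W.expectedCost_ne_top u)
    have h1 := PMF.sum_mul_le_log_sum_exp_add_klDiv (W.outputDist u)
      (W.outputDist fun _ => W.zeroInput) ((hD u).trans_lt htop.lt_top).ne f
    have h2 := ENNReal.toReal_mono htop (hD u)
    rw [ENNReal.toReal_mul, ENNReal.toReal_ofReal hC, toReal_expectedCost] at h2
    have h3 : ∑ y, (W.outputDist u y).toReal * f y = ∑ s, p s * ∑ y, w (u s) s y * f y := by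
      simp only [toReal_outputDist, Finset.sum_mul, Finset.mul_sum]
      rw [Finset.sum_comm]
      simp only [hpdef, hwdef, mul_assoc]
    rw [← h3]
    exact h1.trans (by gcongr; exact h2)
  set lam := Real.log M with hlam
  set f : Fin M → (Fin l → Y) → ℝ := fun m y => if c.dec y = m then lam else 0 with hfdef
  set Z : Fin M → ℝ := fun m => ∑ y : Fin l → Y, (∏ i, q (y i)) * Real.exp (f m y) with hZdef
  have hql : ∑ y : Fin l → Y, ∏ i, q (y i) = 1 :=
    Fintype.sum_prod_apply_eq_one (fun _ => q) fun _ => hq1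
  have hZsum : ∑ m, Z m ≤ 2 * M := by
    simp only [hZdef]
    rw [Finset.sum_comm]
    calc _ = ∑ y : Fin l → Y, (∏ i, q (y i)) * ∑ m, Real.exp (f m y) := by
          simp only [Finset.mul_sum]
      _ ≤ ∑ y : Fin l → Y, (∏ i, q (y i)) * (2 * M) := by
          refine Finset.sum_le_sum fun y _ =>
            mul_le_mul_of_nonneg_left ?_ (Finset.prod_nonneg fun i _ => hq _)
          -- Each output is decoded to exactly one message: one term is `M`, the others are 1.
          calc ∑ m, Real.exp (f m y) ≤ ∑ m : Fin M, ((if c.dec y = m then (M : ℝ) else 0) + 1) := by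
                refine Finset.sum_le_sum fun m _ => ?_
                by_cases h : c.dec y = m
                · simp [hfdef, h, hlam, Real.exp_log hM0]
                · simp [hfdef, h]
            _ = 2 * M := by
                rw [Finset.sum_add_distrib]
                simp
                ring
      _ = 2 * M := by rw [← Finset.sum_mul, hql, one_mul]
  have hZpos : ∀ m, 0 < Z m := fun m => by
    refine lt_of_lt_of_le one_pos ?_
    rw [← hql]
    refine Finset.sum_le_sum fun y _ => le_mul_of_one_le_right
      (Finset.prod_nonneg fun i _ => hq _) (Real.one_le_exp ?_)
    simp only [hfdef]
    split_ifs
    · exact Real.log_natCast_nonneg M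
    · exact le_rfl
  have hmean : ∀ m, (1 - (W.errorProb c m).toReal) * lam ≤ Real.log (Z m) + C * ν := by
    intro m
    have h1 := causal_sum_le_log_sum_exp_add p w q (fun x => (W.cost x : ℝ)) C hp
      W.stateDist.sum_toReal (fun _ _ _ => ENNReal.toReal_nonneg)
      (fun x s => (W.trans x s).sum_toReal) hq hq1 hstep l (c.enc m) (c.causal m) (f m)
    have h2 : ∑ s : Fin l → S, (∏ i, p (s i)) * ∑ i, (W.cost (c.enc m s i) : ℝ) ≤ ν := by
      calc _ ≤ ∑ s : Fin l → S, (∏ i, p (s i)) * ν := by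
            refine Finset.sum_le_sum fun s _ => ?_
            -- The cost constraint says nothing about null state sequences, but they carry no
            -- weight.
            by_cases hs : W.stateSeqProb s = 0
            · have : ∏ i, p (s i) = 0 := by
                rw [← ENNReal.toReal_prod]
                exact congrArg ENNReal.toReal hs
              simp [this]
            · exact mul_le_mul_of_nonneg_left (hcost m s hs)
                (Finset.prod_nonneg fun i _ => hp _)
        _ = ν := by rw [← Finset.sum_mul, W.sum_stateSeq_toReal, one_mul]
    have h3 : ∑ s : Fin l → S, (∏ i, p (s i)) *
        ∑ y : Fin l → Y, (∏ i, w (c.enc m s i) (s i) (y i)) * f m y =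
        (1 - (W.errorProb c m).toReal) * lam := by
      rw [toReal_errorProb, ← W.sum_stateSeq_toReal (l := l), ← Finset.sum_sub_distrib,
        Finset.sum_mul]
      refine Finset.sum_congr rfl fun s _ => ?_
      have h4 := Finset.sum_filter_add_sum_filter_not Finset.univ (fun y => c.dec y = m)
        fun y : Fin l → Y => ∏ i, w (c.enc m s i) (s i) (y i)
      rw [show ∑ y : Fin l → Y, ∏ i, w (c.enc m s i) (s i) (y i) = 1 from
        W.sum_outputSeq_toReal _ s] at h4
      simp only [hfdef, mul_ite, mul_zero, ← Finset.sum_filter, ← Finset.sum_mul]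
      linear_combination (∏ i, p (s i)) * lam * h4
    rw [h3] at h1
    linarith [mul_le_mul_of_nonneg_left h2 hC]
  -- The tangent to `log` at 2, since the average of `Z` is at most 2.
  have hlogZ : ∑ m, Real.log (Z m) ≤ M * Real.log 2 := by
    calc _ ≤ ∑ m, (Z m / 2 - 1 + Real.log 2) := by
          refine Finset.sum_le_sum fun m _ => ?_
          have := Real.log_le_sub_one_of_pos (half_pos (hZpos m))
          rw [Real.log_div (hZpos m).ne' two_ne_zero] at this
          linarith
      _ ≤ M * Real.log 2 := by
          simp only [Finset.sum_add_distrib, Finset.sum_sub_distrib, ← Finset.sum_div,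
            Finset.sum_const, Finset.card_univ, Fintype.card_fin, nsmul_eq_mul]
          linarith
  have herr' := ENNReal.toReal_mono ENNReal.ofReal_ne_top herr
  rw [toReal_avgErrorProb, ENNReal.toReal_ofReal hε.le, div_le_iff₀ hM0] at herr'
  have hsum := Finset.sum_le_sum fun m (_ : m ∈ Finset.univ) => hmean m
  simp only [Finset.sum_add_distrib, ← Finset.sum_mul, Finset.sum_sub_distrib, Finset.sum_const,
    Finset.card_univ, Fintype.card_fin, nsmul_eq_mul, mul_one] at hsum
  have hl0 : 0 ≤ lam := Real.log_natCast_nonneg M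
  refine le_of_mul_le_mul_left ?_ hM0
  nlinarith [mul_le_mul_of_nonneg_right herr' hl0]

theorem le_of_achievable {C R : ℝ} (hC : 0 ≤ C)
    (hD : ∀ u, W.divergenceFromZero u ≤ ENNReal.ofReal C * W.expectedCost u)
    (hR : W.Achievable R) : R ≤ C := by
  by_contra! hlt
  set d := R - C with hd
  have hd0 : 0 < d := sub_pos.2 hlt
  have hR0 : 0 < R := hC.trans_lt hlt
  -- The losses from `ε` and from `γ = d / 4` then use at most half of the gap `d`, and `ν ≥ 4 log 2
  -- / d` makes `log 2` at most another quarter of `ν d`.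
  set ε := d / (4 * R) with hεdef
  have hε : 0 < ε := by positivity
  have hεR : ε * R = d / 4 := by rw [hεdef]; field_simp
  have hε1 : ε < 1 := by
    rw [hεdef, div_lt_one (by positivity)]
    linarith
  obtain ⟨ν₀, hν₀⟩ := hR ε hε hε1 (d / 4) (by positivity)
  set ν := max ν₀ (max 1 (4 * Real.log 2 / d)) with hν
  obtain ⟨l, M, c, hc, hM⟩ := hν₀ ν (le_max_left _ _)
  have hν1 : 1 ≤ ν := (le_max_left _ _).trans (le_max_right _ _)
  have hν2 : 4 * Real.log 2 / d ≤ ν := (le_max_right _ _).trans (le_max_right _ _)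
  rw [div_le_iff₀ hd0] at hν2
  have h1 := W.log_card_le_of_isCode hC hD c hε hc
  have h2 := mul_le_mul_of_nonneg_left hM (sub_pos.2 hε1).le
  have h3 : (1 - ε) * (ν * (R - d / 4)) = ν * (R - d / 4 - d / 4 + ε * (d / 4)) := by
    linear_combination (-ν) * hεR
  have h4 : 0 < ν * (ε * (d / 4)) := by positivity
  have h5 : ν * R = ν * C + ν * d := by rw [hd]; ring
  nlinarith [mul_pos (zero_lt_one.trans_le hν1) hd0]

end StateChannel

/-! ### Pulse position codes with truncated cost. -/

theorem prod_ite_divNat_eq {M n : ℕ} (m : Fin M) (a : ℝ) :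
    (∏ i : Fin (M * n), if i.divNat = m then a else 1) = a ^ n := by
  refine (finProdFinEquiv.symm.prod_comp fun z : Fin M × Fin n =>
    if z.1 = m then a else 1).trans ?_
  rw [Fintype.prod_prod_type_right]
  simp

theorem sum_ite_divNat_eq {M n : ℕ} (m : Fin M) (a : ℝ) :
    (∑ i : Fin (M * n), if i.divNat = m then a else 0) = n * a := by
  refine (finProdFinEquiv.symm.sum_comp fun z : Fin M × Fin n =>
    if z.1 = m then a else 0).trans ?_
  rw [Fintype.sum_prod_type_right]
  simp

namespace StateChannel

variable {X S Y : Type*} (W : StateChannel X S Y) {l M : ℕ}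

/-- The code that follows `c` as long as the accumulated cost of `c` is at most `ν`, and sends the
zero input afterwards. -/
noncomputable def truncatedCode (ν : ℝ) (c : CausalCode X S Y l M) : CausalCode X S Y l M where
  enc m s i := if ∑ k ∈ Finset.Iic i, (W.cost (c.enc m s k) : ℝ) ≤ ν then c.enc m s i
    else W.zeroInput
  causal m i s s' h := by
    have hc : ∀ k, k ≤ i → c.enc m s k = c.enc m s' k := fun k hk =>
      c.causal m k s s' fun j hj => h j (hj.trans hk)
    rw [hc i le_rfl, Finset.sum_congr rfl fun k hk => by rw [hc k (Finset.mem_Iic.1 hk)]]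
  dec := c.dec

theorem sum_cost_truncatedCode_le {ν : ℝ} (hν : 0 ≤ ν) (c : CausalCode X S Y l M) (m : Fin M)
    (s : Fin l → S) : ∑ i, (W.cost ((W.truncatedCode ν c).enc m s i) : ℝ) ≤ ν := by
  have h1 : ∑ i, (W.cost ((W.truncatedCode ν c).enc m s i) : ℝ) =
      ∑ i with ∑ k ∈ Finset.Iic i, (W.cost (c.enc m s k) : ℝ) ≤ ν,
        (W.cost (c.enc m s i) : ℝ) := by
    rw [Finset.sum_filter]
    refine Finset.sum_congr rfl fun i _ => ?_
    simp only [truncatedCode]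
    split_ifs
    · rfl
    · simp [W.cost_zeroInput]
  rw [h1]
  rcases (Finset.univ.filter fun i : Fin l =>
    ∑ k ∈ Finset.Iic i, (W.cost (c.enc m s k) : ℝ) ≤ ν).eq_empty_or_nonempty with h | h
  · rw [h]
    simpa using hν
  -- All inputs kept occur no later than the last kept index, where the running cost is still at
  -- most `ν`.
  · refine le_trans ?_ (Finset.mem_filter.1 (Finset.max'_mem _ h)).2
    exact Finset.sum_le_sum_of_subset_of_nonneg
      (fun i hi => Finset.mem_Iic.2 (Finset.le_max' _ i hi)) fun _ _ _ => NNReal.coe_nonneg _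

theorem truncatedCode_enc_of_le {ν : ℝ} (c : CausalCode X S Y l M) (m : Fin M) (s : Fin l → S)
    (h : ∑ i, (W.cost (c.enc m s i) : ℝ) ≤ ν) : (W.truncatedCode ν c).enc m s = c.enc m s := by
  funext i
  refine if_pos (le_trans ?_ h)
  exact Finset.sum_le_sum_of_subset_of_nonneg (Finset.subset_univ _) fun _ _ _ =>
    NNReal.coe_nonneg _

/-- Truncation changes nothing unless the cost overshoots; on overshooting state sequences the error
is bounded by 1. -/
theorem errorProb_truncatedCode_le [Fintype S] [Fintype Y] (ν : ℝ) (c : CausalCode X S Y l M)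
    (m : Fin M) : (W.errorProb (W.truncatedCode ν c) m).toReal ≤ (W.errorProb c m).toReal +
      ∑ s : Fin l → S with ν < ∑ i, (W.cost (c.enc m s i) : ℝ),
        ∏ i, (W.stateDist (s i)).toReal := by
  rw [toReal_errorProb, toReal_errorProb, Finset.sum_filter, ← Finset.sum_add_distrib]
  refine Finset.sum_le_sum fun s _ => ?_
  have hs : 0 ≤ ∏ i, (W.stateDist (s i)).toReal :=
    Finset.prod_nonneg fun i _ => ENNReal.toReal_nonneg
  have hnn : ∀ (x : Fin l → X) (y : Fin l → Y), 0 ≤ ∏ i, (W.trans (x i) (s i) (y i)).toReal :=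
    fun x y => Finset.prod_nonneg fun i _ => ENNReal.toReal_nonneg
  split_ifs with h
  · have h1 : ∑ y : Fin l → Y with (W.truncatedCode ν c).dec y ≠ m,
        ∏ i, (W.trans ((W.truncatedCode ν c).enc m s i) (s i) (y i)).toReal ≤ 1 := by
      rw [← W.sum_outputSeq_toReal ((W.truncatedCode ν c).enc m s) s]
      exact Finset.sum_le_sum_of_subset_of_nonneg (Finset.filter_subset _ _) fun y _ _ => hnn _ y
    have h2 : 0 ≤ ∑ y : Fin l → Y with c.dec y ≠ m,
        ∏ i, (W.trans (c.enc m s i) (s i) (y i)).toReal := Finset.sum_nonneg fun y _ => hnn _ y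
    nlinarith [mul_le_mul_of_nonneg_left h1 hs, mul_nonneg hs h2]
  · rw [W.truncatedCode_enc_of_le c m s (not_lt.1 h), add_zero]
    exact le_rfl

/-- The code whose `i`-th input for message `m` depends on the current state only. -/
def memorylessCode (v : Fin M → Fin l → S → X) (dec : (Fin l → Y) → Fin M) :
    CausalCode X S Y l M where
  enc m s i := v m i (s i)
  causal m i s s' h := by rw [h i le_rfl]
  dec := dec

/-- Summing out the independent states factorizes over time, leaving independent outputs with laws
`outputDist`. -/
theorem toReal_errorProb_memorylessCode [Fintype S] [Fintype Y] (v : Fin M → Fin l → S → X)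
    (dec : (Fin l → Y) → Fin M) (m : Fin M) :
    (W.errorProb (memorylessCode v dec) m).toReal =
      ∑ y : Fin l → Y with dec y ≠ m, ∏ i, (W.outputDist (v m i) (y i)).toReal := by
  classical
  rw [toReal_errorProb]
  simp only [Finset.mul_sum]
  rw [Finset.sum_comm]
  refine Finset.sum_congr rfl fun y _ => ?_
  simp only [toReal_outputDist]
  rw [Finset.prod_univ_sum, Fintype.piFinset_univ]
  refine Finset.sum_congr rfl fun s _ => ?_
  rw [Finset.prod_mul_distrib]
  rfl

variable [Fintype S] [Fintype Y]

/-- The pulse position code: message `m` is signalled by using `u` in the `m`-th of `M` slots of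
length `n`, and decoded by comparing the sum of `L` over each slot with a threshold. -/
theorem exists_pulsePositionCode (u : S → X) (L : Y → ℝ) {r β t : ℝ} (ht : 0 < t)
    (hL : ∑ y, (W.outputDist (fun _ => W.zeroInput) y).toReal * Real.exp (L y) ≤ 1)
    {n : ℕ} {ν : ℝ} (hβ : 0 ≤ β) (hν : n * β ≤ ν) (hM : 1 ≤ M) :
    ∃ c : CausalCode X S Y (M * n) M,
      (∀ m s, ∑ i, (W.cost (c.enc m s i) : ℝ) ≤ ν) ∧
      ∀ m, (W.errorProb c m).toReal ≤
        (∑ y, (W.outputDist u y).toReal * Real.exp (t * (r - L y))) ^ n + M * Real.exp (-r) ^ n +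
        (∑ s, (W.stateDist s).toReal * Real.exp (t * (W.cost (u s) - β))) ^ n := by
  classical
  let T : Fin M → (Fin (M * n) → Y) → ℝ := fun m y =>
    ∑ i, if i.divNat = m then L (y i) - r else 0
  let v : Fin M → Fin (M * n) → S → X := fun m i =>
    if i.divNat = m then u else fun _ => W.zeroInput
  -- The decoder picks any slot with positive score. Both error events are stated with weak
  -- inequalities to suit the Chernoff bound.
  obtain ⟨dec, hdec⟩ : ∃ dec : (Fin (M * n) → Y) → Fin M, ∀ y m, dec y ≠ m →
      T m y ≤ 0 ∨ ∃ m', m' ≠ m ∧ 0 ≤ T m' y := by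
    refine ⟨fun y => if h : ∃ m, 0 < T m y then h.choose else ⟨0, hM⟩, fun y m hne => ?_⟩
    by_cases h : ∃ m, 0 < T m y
    · simp only [dif_pos h] at hne
      exact Or.inr ⟨h.choose, hne, h.choose_spec.le⟩
    · push Not at h
      exact Or.inl (h m)
  refine ⟨W.truncatedCode ν (memorylessCode v dec), fun m s =>
    W.sum_cost_truncatedCode_le ((by positivity : (0 : ℝ) ≤ n * β).trans hν) _ m s, fun m => ?_⟩
  refine (W.errorProb_truncatedCode_le ν _ m).trans ?_
  rw [toReal_errorProb_memorylessCode]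
  set P : Fin (M * n) → Y → ℝ := fun i y => (W.outputDist (v m i) y).toReal with hP
  have hP0 : ∀ i y, 0 ≤ P i y := fun i y => ENNReal.toReal_nonneg
  have hP1 : ∀ i, ∑ y, P i y = 1 := fun i => PMF.sum_toReal _
  have hPn : ∀ y : Fin (M * n) → Y, 0 ≤ ∏ i, P i (y i) := fun y =>
    Finset.prod_nonneg fun i _ => hP0 _ _
  have hmiss : ∑ y : Fin (M * n) → Y with T m y ≤ 0, ∏ i, P i (y i) ≤
      (∑ y, (W.outputDist u y).toReal * Real.exp (t * (r - L y))) ^ n := by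
    have h := sum_prod_filter_le_prod_sum_exp P
      (fun i y => if i.divNat = m then t * (r - L y) else 0) hP0
    have hset : (Finset.univ.filter fun y : Fin (M * n) → Y => T m y ≤ 0) ⊆
        Finset.univ.filter fun y : Fin (M * n) → Y =>
          0 ≤ ∑ i, if i.divNat = m then t * (r - L (y i)) else 0 := by
      intro y hy
      have hy' := (Finset.mem_filter.1 hy).2
      have : (∑ i, if i.divNat = m then t * (r - L (y i)) else 0) = -(t * T m y) := by
        simp only [T, Finset.mul_sum, ← Finset.sum_neg_distrib]
        refine Finset.sum_congr rfl fun i _ => ?_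
        split_ifs <;> ring
      rw [Finset.mem_filter, this]
      exact ⟨Finset.mem_univ _, by nlinarith⟩
    refine (Finset.sum_le_sum_of_subset_of_nonneg hset fun y _ _ => hPn y).trans (h.trans_eq ?_)
    rw [← prod_ite_divNat_eq (n := n) m]
    refine Finset.prod_congr rfl fun i _ => ?_
    by_cases hi : i.divNat = m
    · simp [P, v, hi]
    · simp [hi, hP1]
  have hfalse : ∀ m', m' ≠ m → ∑ y : Fin (M * n) → Y with 0 ≤ T m' y, ∏ i, P i (y i) ≤
      Real.exp (-r) ^ n := by
    intro m' hm'
    -- False alarms are tilted with parameter 1, not `t`, because `hL` controls exactly this moment.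
    refine (sum_prod_filter_le_prod_sum_exp P
      (fun i y => if i.divNat = m' then L y - r else 0) hP0).trans ?_
    rw [← prod_ite_divNat_eq (n := n) m']
    refine Finset.prod_le_prod (fun i _ => Finset.sum_nonneg fun y _ =>
      mul_nonneg (hP0 _ _) (Real.exp_nonneg _)) fun i _ => ?_
    by_cases hi : i.divNat = m'
    · simp only [hi, if_true, P, v, sub_eq_add_neg, Real.exp_add, ← mul_assoc,
        ← Finset.sum_mul, if_neg hm']
      exact mul_le_of_le_one_left (Real.exp_nonneg _) hL
    · simp [hi, hP1]
  have hcost : ∑ s : Fin (M * n) → S with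
        ν < ∑ i, (W.cost ((memorylessCode (Y := Y) v dec).enc m s i) : ℝ),
        ∏ i, (W.stateDist (s i)).toReal ≤
      (∑ s, (W.stateDist s).toReal * Real.exp (t * (W.cost (u s) - β))) ^ n := by
    have h := sum_prod_filter_le_prod_sum_exp (fun (_ : Fin (M * n)) s => (W.stateDist s).toReal)
      (fun i s => if i.divNat = m then t * (W.cost (u s) - β) else 0)
      fun _ _ => ENNReal.toReal_nonneg
    have hset : (Finset.univ.filter fun s : Fin (M * n) → S =>
        ν < ∑ i, (W.cost ((memorylessCode (Y := Y) v dec).enc m s i) : ℝ)) ⊆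
        Finset.univ.filter fun s : Fin (M * n) → S =>
          0 ≤ ∑ i, if i.divNat = m then t * (W.cost (u (s i)) - β) else 0 := by
      intro s hs
      have hs' := (Finset.mem_filter.1 hs).2
      have h1 : (∑ i, if i.divNat = m then t * ((W.cost (u (s i)) : ℝ) - β) else 0) =
          t * (∑ i, (W.cost ((memorylessCode (Y := Y) v dec).enc m s i) : ℝ) - n * β) := by
        rw [← sum_ite_divNat_eq m β, ← Finset.sum_sub_distrib, Finset.mul_sum]
        refine Finset.sum_congr rfl fun i _ => ?_
        by_cases hi : i.divNat = m
        · simp [memorylessCode, v, hi]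
        · simp [memorylessCode, v, hi, W.cost_zeroInput]
      rw [Finset.mem_filter, h1]
      exact ⟨Finset.mem_univ _, mul_nonneg ht.le (by linarith)⟩
    refine (Finset.sum_le_sum_of_subset_of_nonneg hset fun y _ _ =>
      Finset.prod_nonneg fun i _ => ENNReal.toReal_nonneg).trans (h.trans_eq ?_)
    rw [← prod_ite_divNat_eq (n := n) m]
    refine Finset.prod_congr rfl fun i _ => ?_
    by_cases hi : i.divNat = m
    · simp [hi]
    · simp [hi, PMF.sum_toReal]
  refine add_le_add ?_ hcost
  calc _ ≤ ∑ y : Fin (M * n) → Y, ((if T m y ≤ 0 then ∏ i, P i (y i) else 0) +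
        ∑ m' with m' ≠ m, if 0 ≤ T m' y then ∏ i, P i (y i) else 0) := by
        rw [Finset.sum_filter]
        refine Finset.sum_le_sum fun y _ => ?_
        have h0 : ∀ (q : Prop) [Decidable q], 0 ≤ if q then ∏ i, P i (y i) else 0 :=
          fun q _ => ite_nonneg (hPn y) le_rfl
        have h1 := Finset.sum_nonneg fun m' (_ : m' ∈ Finset.univ.filter (· ≠ m)) =>
          h0 (0 ≤ T m' y)
        by_cases h : dec y = m
        · rw [if_neg (not_not.2 h)]
          exact add_nonneg (h0 _) h1
        rw [if_pos h]
        rcases hdec y m h with h | ⟨m', hm', h⟩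
        · rw [if_pos h]
          exact le_add_of_nonneg_right h1
        · refine le_add_of_nonneg_of_le (h0 _) ?_
          refine le_trans (by rw [if_pos h]) (Finset.single_le_sum (fun m' _ => h0 (0 ≤ T m' y))
            (Finset.mem_filter.2 ⟨Finset.mem_univ m', hm'⟩))
    _ = ∑ y : Fin (M * n) → Y with T m y ≤ 0, ∏ i, P i (y i) +
        ∑ m' with m' ≠ m, ∑ y : Fin (M * n) → Y with 0 ≤ T m' y, ∏ i, P i (y i) := by
        rw [Finset.sum_add_distrib, Finset.sum_comm]
        simp only [Finset.sum_filter]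
    _ ≤ _ := by
        refine add_le_add hmiss ((Finset.sum_le_sum fun m' hm' =>
          hfalse m' (Finset.mem_filter.1 hm').2).trans ?_)
        rw [Finset.sum_const, nsmul_eq_mul]
        refine mul_le_mul_of_nonneg_right ?_ (by positivity)
        exact_mod_cast (Finset.card_filter_le _ _).trans (by simp)

end StateChannel

/-! ### Achievability and the capacity formula. -/

namespace StateChannel

variable {X S Y : Type*} [Fintype S] [Fintype Y] (W : StateChannel X S Y)

/-- A code with a single message. -/
theorem exists_isCode_one {ν ε : ℝ} (hν : 0 ≤ ν) :
    ∃ c : CausalCode X S Y 0 1, W.IsCode c ν ε := by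
  refine ⟨⟨fun _ _ i => i.elim0, fun _ i => i.elim0, fun _ => 0⟩, le_rfl, ?_, by simp [hν]⟩
  simp [avgErrorProb, errorProb, Subsingleton.elim _ (0 : Fin 1)]

variable [MeasurableSpace Y] [MeasurableSingletonClass Y]

theorem exists_isCode_of_lt_divergenceFromZero (u : S → X) {R : ℝ} (hR : 0 ≤ R)
    (h : ENNReal.ofReal R * W.expectedCost u < W.divergenceFromZero u) {ε : ℝ} (hε : 0 < ε) :
    ∃ ν₀ : ℝ, ∀ ν : ℝ, ν₀ ≤ ν →
      ∃ (l M : ℕ) (c : CausalCode X S Y l M), W.IsCode c ν ε ∧ ν * R ≤ Real.log M := by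
  set B := (W.expectedCost u).toReal with hB
  have hB0 : 0 ≤ B := ENNReal.toReal_nonneg
  rw [← ENNReal.ofReal_toReal (W.expectedCost_ne_top u), ← ENNReal.ofReal_mul hR] at h
  obtain ⟨r, h, hr⟩ := ENNReal.lt_iff_exists_nnreal_btwn.1 h
  obtain ⟨r', hr', hrr'⟩ := ENNReal.lt_iff_exists_nnreal_btwn.1 h
  have hrr : (r' : ℝ) < r := by exact_mod_cast hrr'
  have hRB : R * B < r' := by
    rw [← ENNReal.ofReal_coe_nnreal] at hr'
    exact (ENNReal.ofReal_lt_ofReal_iff'.1 hr').1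
  obtain ⟨β, hβB, hβr⟩ : ∃ β : ℝ, B < β ∧ R * β < r' := by
    -- The factor `R / (R + 1) < 1` keeps `R * β` below `r'`; `β` is positive even when the expected
    -- cost `B` is 0.
    refine ⟨B + (r' - R * B) / (R + 1), ?_, ?_⟩
    · have : 0 < (r' - R * B) / (R + 1) := div_pos (by linarith) (by linarith)
      linarith
    · have : R * ((r' - R * B) / (R + 1)) < r' - R * B := by
        rw [mul_div_assoc', div_lt_iff₀ (by linarith)]
        nlinarith
      linarith
  have hβ : 0 < β := hB0.trans_lt hβB
  obtain ⟨L, hL1, hLr⟩ := PMF.exists_sum_mul_exp_le_one (W.outputDist u)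
    (W.outputDist fun _ => W.zeroInput) (r := r) (by rwa [ENNReal.ofReal_coe_nnreal])
  obtain ⟨t, ht1, ht2, ht⟩ := ((eventually_sum_mul_exp_lt_one
    (fun y => (W.outputDist u y).toReal) (fun y => r - L y) (PMF.sum_toReal _) (by
      simp only [mul_sub, Finset.sum_sub_distrib, ← Finset.sum_mul, PMF.sum_toReal]
      linarith)).and ((eventually_sum_mul_exp_lt_one
    (fun s => (W.stateDist s).toReal) (fun s => (W.cost (u s) : ℝ) - β) (PMF.sum_toReal _) (by
      simp only [mul_sub, Finset.sum_sub_distrib, ← Finset.sum_mul, PMF.sum_toReal]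
      rw [toReal_expectedCost] at hB
      linarith)).and self_mem_nhdsWithin)).exists
  set ρ₁ := ∑ y, (W.outputDist u y).toReal * Real.exp (t * (r - L y)) with hρ₁
  set ρ₂ := ∑ s, (W.stateDist s).toReal * Real.exp (t * (W.cost (u s) - β)) with hρ₂
  have hρ₁0 : 0 ≤ ρ₁ := Finset.sum_nonneg fun y _ =>
    mul_nonneg ENNReal.toReal_nonneg (Real.exp_nonneg _)
  have hρ₂0 : 0 ≤ ρ₂ := Finset.sum_nonneg fun y _ =>
    mul_nonneg ENNReal.toReal_nonneg (Real.exp_nonneg _)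
  have hr0 : (0 : ℝ) < r := r'.coe_nonneg.trans_lt hrr
  have hlim : Filter.Tendsto (fun n : ℕ => ρ₁ ^ n +
      (Real.exp (r' - r) ^ n + Real.exp (-r) ^ n) + ρ₂ ^ n) Filter.atTop (nhds 0) := by
    simpa using ((tendsto_pow_atTop_nhds_zero_of_lt_one hρ₁0 ht1).add
      ((tendsto_pow_atTop_nhds_zero_of_lt_one (Real.exp_nonneg (r' - r))
        (Real.exp_lt_one_iff.2 (by linarith))).add
      (tendsto_pow_atTop_nhds_zero_of_lt_one (Real.exp_nonneg (-r))
        (Real.exp_lt_one_iff.2 (by linarith))))).add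
      (tendsto_pow_atTop_nhds_zero_of_lt_one hρ₂0 ht2)
  obtain ⟨N, hN⟩ := Filter.eventually_atTop.1 (hlim.eventually_le_const hε)
  -- The first bound gives `n ≥ N`; the second absorbs the loss from rounding `ν / β` down, so that
  -- `ν * R ≤ n * r'`.
  refine ⟨max (β * N) (β * r' / (r' - R * β)), fun ν hν => ?_⟩
  have hν1 : β * N ≤ ν := (le_max_left _ _).trans hν
  have hν2 : β * r' / (r' - R * β) ≤ ν := (le_max_right _ _).trans hν
  have hν0 : 0 ≤ ν := (by positivity : 0 ≤ β * N).trans hν1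
  set n := ⌊ν / β⌋₊ with hn
  have hnN : N ≤ n := Nat.le_floor (by rw [le_div_iff₀ hβ]; linarith)
  have hnβ : n * β ≤ ν := (le_div_iff₀ hβ).1 (Nat.floor_le (by positivity))
  have hn1 : ν < (n + 1) * β := (div_lt_iff₀ hβ).1 (Nat.lt_floor_add_one _)
  set M := ⌈Real.exp (n * r')⌉₊ with hMdef
  have hM : 1 ≤ M := Nat.one_le_ceil_iff.2 (Real.exp_pos _)
  obtain ⟨c, hcost, herr⟩ := W.exists_pulsePositionCode u L ht hL1 hβ.le hnβ hM
  have herr' : ∀ m, (W.errorProb c m).toReal ≤ ε := by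
    intro m
    refine (herr m).trans (le_trans ?_ (hN n hnN))
    rw [← hρ₁, ← hρ₂]
    gcongr
    calc (M : ℝ) * Real.exp (-r) ^ n ≤ (Real.exp (n * r') + 1) * Real.exp (-r) ^ n := by
          gcongr
          exact (Nat.ceil_lt_add_one (Real.exp_nonneg _)).le
      _ = _ := by
          rw [sub_eq_add_neg, Real.exp_add, mul_pow, Real.exp_nat_mul]
          ring
  refine ⟨M * n, M, c, ⟨hM, ?_, fun m s _ => hcost m s⟩, ?_⟩
  · have hM0 : (0 : ℝ) < M := by exact_mod_cast hM
    have hne : W.avgErrorProb c ≠ ∞ :=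
      ENNReal.div_ne_top (ENNReal.sum_ne_top.2 fun m _ => W.errorProb_ne_top c m)
        (by exact_mod_cast hM0.ne')
    rw [ENNReal.le_ofReal_iff_toReal_le hne hε.le, toReal_avgErrorProb, div_le_iff₀ hM0]
    calc _ ≤ ∑ _m : Fin M, ε := Finset.sum_le_sum fun m _ => herr' m
      _ = ε * M := by simp [mul_comm]
  · rw [div_le_iff₀ (by linarith)] at hν2
    have h1 : ν * R ≤ n * r' := by
      refine le_of_mul_le_mul_left ?_ hβ
      nlinarith [mul_le_mul_of_nonneg_right hn1.le r'.coe_nonneg]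
    refine h1.trans ?_
    rw [Real.le_log_iff_exp_le (by exact_mod_cast hM)]
    exact Nat.le_ceil _

theorem achievable_of_le_iSup {R : ℝ}
    (hR : ENNReal.ofReal R ≤ ⨆ u : S → X, W.divergenceFromZero u / W.expectedCost u) :
    W.Achievable R := by
  intro ε hε _ γ hγ
  rcases le_or_gt (R - γ) 0 with h | h
  · refine ⟨0, fun ν hν => ?_⟩
    obtain ⟨c, hc⟩ := W.exists_isCode_one (ε := ε) hν
    refine ⟨0, 1, c, hc, ?_⟩
    simpa using mul_nonpos_of_nonneg_of_nonpos hν h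
  · have hlt : ENNReal.ofReal (R - γ) <
        ⨆ u : S → X, W.divergenceFromZero u / W.expectedCost u :=
      lt_of_lt_of_le ((ENNReal.ofReal_lt_ofReal_iff (by linarith)).2 (by linarith)) hR
    obtain ⟨u, hu⟩ := lt_iSup_iff.1 hlt
    refine W.exists_isCode_of_lt_divergenceFromZero u h.le ?_ hε
    exact ENNReal.mul_lt_of_lt_div hu

theorem ofReal_le_iSup_of_achievable {R : ℝ} (hR : W.Achievable R) :
    ENNReal.ofReal R ≤ ⨆ u : S → X, W.divergenceFromZero u / W.expectedCost u := by
  set C := ⨆ u : S → X, W.divergenceFromZero u / W.expectedCost u with hC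
  by_cases hCtop : C = ∞
  · simp [hCtop]
  rw [ENNReal.ofReal_le_iff_le_toReal hCtop]
  refine W.le_of_achievable ENNReal.toReal_nonneg (fun u => ?_) hR
  rw [ENNReal.ofReal_toReal hCtop]
  have hu : W.divergenceFromZero u / W.expectedCost u ≤ C :=
    le_iSup (fun u => W.divergenceFromZero u / W.expectedCost u) u
  -- At zero expected cost, finiteness of `C` excludes `a / 0 = ∞` and forces the divergence to
  -- vanish.
  refine (ENNReal.div_le_iff_le_mul (Or.inr hCtop) (Or.inl (W.expectedCost_ne_top u))).1 hu

theorem capacityPerUnitCost_eq_iSup : W.capacityPerUnitCost =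
    ⨆ u : S → X, W.divergenceFromZero u / W.expectedCost u := by
  refine le_antisymm (iSup₂_le fun R hR => ?_) (ENNReal.le_of_forall_nnreal_lt fun R hR => ?_)
  · simpa using W.ofReal_le_iSup_of_achievable hR
  · exact le_iSup₂_of_le R (W.achievable_of_le_iSup (by simpa using hR.le)) le_rfl

end StateChannel

/-- In the quotient (taken in `[0, ∞]`) one has `0 / 0 = 0` and `a / 0 = ∞` for `a ≠ 0`. The second
part says that a finite capacity is itself an achievable rate, so that it is a maximum. -/
theorem theorem2 {X S Y : Type*} [Fintype S] [Fintype Y] [MeasurableSpace Y]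
    [MeasurableSingletonClass Y] (W : StateChannel X S Y) :
    (W.capacityPerUnitCost = ⨆ u : S → X, W.divergenceFromZero u / W.expectedCost u) ∧
      (W.capacityPerUnitCost ≠ ∞ → W.Achievable W.capacityPerUnitCost.toReal) := by
  refine ⟨W.capacityPerUnitCost_eq_iSup, fun h => W.achievable_of_le_iSup ?_⟩
  rw [ENNReal.ofReal_toReal h, W.capacityPerUnitCost_eq_iSup]
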